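/- Let $K$ be a field, let $n\ge 4$ be even, and read all indices of variables modulo $n$. Let $S=K[x_1,\dots,x_n]$, let $R=K[y_1,\dots,y_n]$, and let $T=S[y_1,\dots,y_n]$. Let $I=I_{n/2}(C_n)\subset S$ be the $\frac n2$-path ideal of the $n$-cycle $C_n$ (with edges $\{x_i,x_{i+1}\}$), that is, the ideal generated by the products of the vertices of the paths of $C_n$ on $\frac n2$ vertices. Then $I=(u_1,\dots,u_n)$ with $u_j=x_jx_{j+1}\cdots x_{j+n/2-1}$. Let $\mathcal R(I)=S[u_1s,\dots,u_ns]\subset S[s]$ be the Rees algebra of $I$, let $\varphi:T\to\mathcal R(I)$ be the $S$-algebra homomorphism with $\varphi(y_j)=u_js$, and let $J=\ker\varphi$ be the defining ideal of $\mathcal R(I)$. Let $L\subset T$ be the defining ideal of the symmetric algebra of $I$, generated by all linear forms $\sum_j a_jy_j$ with $a_j\in S$ and $\sum_j a_ju_j=0$. Let $\mathfrak m=(x_1,\dots,x_n)$ and let $H\subset R$ be the ideal of fiber relations, that is, the kernel of the map from $R\cong T/\mathfrak mT$ to the fiber cone $\mathcal R(I)/\mathfrak m\mathcal R(I)$ induced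 by $\varphi$. Then $$L=(f_1,\dots,f_n),\qquad f_j=x_{\frac n2+j}\,y_j-x_j\,y_{j+1}\quad (j=1,\dots,n),$$ $$H=(h_1,\dots,h_{\frac n2-1}),\qquad h_l=y_l\,y_{l+\frac n2}-y_0\,y_{\frac n2}\quad (l=1,\dots,\tfrac n2-1),$$ and $$J=L+HT=(f_1,\dots,f_n,h_1,\dots,h_{\frac n2-1})\,T.$$ In particular, $I_{n/2}(C_n)$ is of fiber type, i.e. $J$ is generated by the linear relations $L$ and the fiber relations $H$. -/

import Mathlib

open MvPolynomial

noncomputable section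

namespace ReesPath

section General

variable {σ ι K : Type*} [Field K]

/-- The bigraded polynomial ring `T = S[y_i | i ∈ ι]` over `S = K[x_v | v ∈ σ]`:
the variable `x_v` is `C (X v)` and the variable `y_i` is `X i`. -/
abbrev BigRing (σ ι K : Type*) [Field K] : Type _ :=
  MvPolynomial ι (MvPolynomial σ K)

/-- The `t`-path ideal of a simple graph: the ideal of `K[x_v | v ∈ V]` generated by the products
of the variables along the paths on `t` vertices (that is, with no repeated vertex). -/
def pathIdeal (K : Type*) [Field K] {V : Type*} (G : SimpleGraph V) (t : ℕ) :
    Ideal (MvPolynomial V K) :=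
  Ideal.span {m | ∃ (v w : V) (p : G.Walk v w), p.IsPath ∧ p.support.length = t ∧
    m = (p.support.map X).prod}

/-- The ideal `I = (u_i | i ∈ ι)` generated by a family of polynomials. -/
def genIdeal (u : ι → MvPolynomial σ K) : Ideal (MvPolynomial σ K) :=
  Ideal.span (Set.range u)

/-- The generator `u_i s` of the Rees algebra `R(I) ⊆ S[s]`, for `I = (u_i | i ∈ ι)`. -/
def reesGen (u : ι → MvPolynomial σ K) (i : ι) : reesAlgebra (genIdeal u) :=
  ⟨Polynomial.monomial 1 (u i), reesAlgebra.monomial_mem.mpr (by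
    rw [pow_one]; exact Ideal.subset_span ⟨i, rfl⟩)⟩

/-- The `S`-algebra homomorphism `φ : T → R(I)` with `y_i ↦ u_i s`. -/
def reesMap (u : ι → MvPolynomial σ K) :
    BigRing σ ι K →ₐ[MvPolynomial σ K] reesAlgebra (genIdeal u) :=
  aeval (reesGen u)

/-- The defining ideal `J = ker φ` of the Rees algebra of `I = (u_i | i ∈ ι)`. -/
def definingIdeal (u : ι → MvPolynomial σ K) : Ideal (BigRing σ ι K) :=
  RingHom.ker (reesMap u)

/-- The defining ideal `L` of the symmetric algebra of `I = (u_i | i ∈ ι)`: it is generated by the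
linear forms `∑ a_i y_i` for all relations `∑ a_i u_i = 0` with coefficients `a_i ∈ S`. -/
def linearRelations (u : ι → MvPolynomial σ K) : Ideal (BigRing σ ι K) :=
  Ideal.span {l | ∃ a : ι →₀ MvPolynomial σ K,
    (a.sum fun i c => c * u i) = 0 ∧ l = a.sum fun i c => C c * X i}

/-- The graded maximal ideal `𝔪` of `S = K[x_v | v ∈ σ]`. -/
def maxIdeal (σ K : Type*) [Field K] : Ideal (MvPolynomial σ K) :=
  Ideal.span (Set.range X)

/-- The extension `𝔪 R(I)` of the graded maximal ideal to the Rees algebra. -/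
def maxReesIdeal (u : ι → MvPolynomial σ K) : Ideal (reesAlgebra (genIdeal u)) :=
  (maxIdeal σ K).map (algebraMap (MvPolynomial σ K) (reesAlgebra (genIdeal u)))

/-- The fiber cone `F(I) = R(I) / 𝔪 R(I)`. -/
abbrev FiberCone (u : ι → MvPolynomial σ K) : Type _ :=
  reesAlgebra (genIdeal u) ⧸ maxReesIdeal u

/-- The inclusion of `R = K[y_i | i ∈ ι]` into `T = S[y_i | i ∈ ι]`. -/
def inclY (σ ι K : Type*) [Field K] : MvPolynomial ι K →+* BigRing σ ι K :=
  MvPolynomial.map C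

/-- The map `φ' : K[y_i | i ∈ ι] ≅ T / 𝔪 T → F(I)` induced by `φ`. -/
def fiberMap (u : ι → MvPolynomial σ K) : MvPolynomial ι K →+* FiberCone u :=
  (Ideal.Quotient.mk (maxReesIdeal u)).comp ((reesMap u).toRingHom.comp (inclY σ ι K))

/-- The ideal `H = ker φ'` of fiber relations. -/
def fiberRelations (u : ι → MvPolynomial σ K) : Ideal (MvPolynomial ι K) :=
  RingHom.ker (fiberMap u)

/-- `I = (u_i | i ∈ ι)` is of fiber type if `J = L + H T`. -/
def IsFiberType (u : ι → MvPolynomial σ K) : Prop :=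
  definingIdeal u = linearRelations u + (fiberRelations u).map (inclY σ ι K)

end General

/-- The `n`-cycle `C_n` (for `n ≥ 3`): the graph on `ℤ/n` with edges `{i, i + 1}`. -/
def cycle (n : ℕ) : SimpleGraph (ZMod n) :=
  SimpleGraph.circulantGraph {1}

/-- The monomial `u_j = x_j x_{j+1} ⋯ x_{j+t-1}`, with indices modulo `n`. -/
def cyclePathMonomial (K : Type*) [Field K] (n t : ℕ) (j : ZMod n) : MvPolynomial (ZMod n) K :=
  ∏ k ∈ Finset.range t, X (j + (k : ZMod n))

/-- The polynomial `f_j = x_{n/2+j} y_j - x_j y_{j+1}`, with indices modulo `n`. -/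
def f (K : Type*) [Field K] (n : ℕ) (j : ZMod n) : BigRing (ZMod n) (ZMod n) K :=
  C (X (((n / 2 : ℕ) : ZMod n) + j)) * X j - C (X j) * X (j + 1)

/-- The polynomial `h_l = y_l y_{l+n/2} - y_0 y_{n/2}`, with indices modulo `n`. -/
def h (K : Type*) [Field K] (n l : ℕ) : MvPolynomial (ZMod n) K :=
  X (l : ZMod n) * X ((l + n / 2 : ℕ) : ZMod n) - X 0 * X ((n / 2 : ℕ) : ZMod n)

end ReesPath

end

/-! ### Combinatorics of the exponents of the `u_j` on the cycle. -/

open MvPolynomial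

noncomputable section

namespace ReesPath

/-! Put n = 2m and write E for `pathExp`. As φ sends x^a y^b to x^(a+E(b)) s^|b|, the kernel J is
spanned by the binomials x^a y^b - x^c y^d with |b| = |d| and a+E(b) = c+E(d)
(`mem_of_reesEval_eq_zero`).

Complementary half-cycles give E(b)_i + E(b)_{i+m} = |b|, so a - c changes sign under i ↦ i+m. If a
≠ c, then a - c is positive somewhere and must drop after some j with a_j > c_j. The drop forces
y_{j+1} ∣ y^b, or symmetrically y_{j+1+m} ∣ y^d. Rewriting with f_j (or f_{j+m}) then creates a
common x-variable, whose cancellation lowers |a|+|c| (`biMonomial_sub_mem`).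

If a = c, then b - d is invariant under i ↦ i+m. If b ≠ d, both y-monomials contain antipodal pairs;
the h_l exchange these pairs, and one cancels (`monomial_sub_mem_of_antipodal`). In y-degree 1 there
is no room for a pair, whence L = (f_j). Setting x = 0 kills the f_j and fixes the h_l, whence H =
(h_l). -/

/-- The exponent vector of `x_j x_{j+1} ⋯ x_{j+t-1}`, extended additively to multisets of indices. -/
def pathExp (n t : ℕ) : (ZMod n →₀ ℕ) →ₗ[ℕ] (ZMod n →₀ ℕ) :=
  Finsupp.linearCombination ℕ fun j => ∑ k ∈ Finset.range t, Finsupp.single (j + (k : ZMod n)) 1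

lemma pathExp_single (n t : ℕ) (j : ZMod n) :
    pathExp n t (Finsupp.single j 1) =
      ∑ k ∈ Finset.range t, Finsupp.single (j + (k : ZMod n)) 1 := by
  simp [pathExp]

lemma pathExp_apply (n t : ℕ) (b : ZMod n →₀ ℕ) (i : ZMod n) :
    pathExp n t b i = ∑ k ∈ Finset.range t, b (i - k) := by
  classical
  induction b using Finsupp.induction_linear with
  | zero => simp
  | add b c hb hc => simp [hb, hc, Finset.sum_add_distrib]
  | single j k =>
    simp only [pathExp, Finsupp.linearCombination_single, Finsupp.smul_apply,
      Finsupp.finsetSum_apply, Finsupp.single_apply, smul_eq_mul, Finset.mul_sum, mul_ite, mul_one,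
      mul_zero, eq_sub_iff_add_eq]

/-- Both sides sum b over the t+1 indices ending at i+1; the windows of i and i+1 differ only in
their ends. -/
lemma pathExp_succ (n t : ℕ) (b : ZMod n →₀ ℕ) (i : ZMod n) :
    pathExp n t b (i + 1) + b (i + 1 - t) = pathExp n t b i + b (i + 1) := by
  rw [pathExp_apply, pathExp_apply,
    ← Finset.sum_range_succ (fun k : ℕ => b (i + 1 - (k : ZMod n))), Finset.sum_range_succ']
  simp

lemma sum_range_sub_eq_degree (n : ℕ) [NeZero n] (b : ZMod n →₀ ℕ) (i : ZMod n) :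
    ∑ k ∈ Finset.range n, b (i - k) = b.degree := by
  rw [Finsupp.degree_eq_sum]
  refine Finset.sum_bij (fun k _ => i - (k : ZMod n)) (by simp) ?_ ?_ (by simp)
  · intro k hk l hl hkl
    have h : (k : ZMod n) = l := sub_right_injective hkl
    rw [ZMod.natCast_eq_natCast_iff', Nat.mod_eq_of_lt (Finset.mem_range.mp hk),
      Nat.mod_eq_of_lt (Finset.mem_range.mp hl)] at h
    exact h
  · intro j _
    exact ⟨(i - j).val, Finset.mem_range.mpr (ZMod.val_lt _), by simp⟩

lemma natCast_add_natCast_half (m : ℕ) : (m : ZMod (m + m)) + m = 0 := by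
  rw [← Nat.cast_add, ZMod.natCast_self]

lemma sub_natCast_half (m : ℕ) (i : ZMod (m + m)) : i - m = i + m := by
  rw [sub_eq_iff_eq_add, add_assoc, natCast_add_natCast_half, add_zero]

lemma add_natCast_half_add (m : ℕ) (i : ZMod (m + m)) : i + m + m = i := by
  rw [add_assoc, natCast_add_natCast_half, add_zero]

/-- The windows of length m ending at i and at i+m partition the cycle. -/
lemma pathExp_add_half (m : ℕ) [NeZero (m + m)] (b : ZMod (m + m) →₀ ℕ) (i : ZMod (m + m)) :
    pathExp (m + m) m b i + pathExp (m + m) m b (i + m) = b.degree := by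
  rw [pathExp_apply, pathExp_apply, ← sum_range_sub_eq_degree _ b i, Finset.sum_range_add]
  simp [← sub_sub, sub_natCast_half]

/-- Both sides are the exponent of x_j ⋯ x_{j+t}; this is the syzygy behind f_j. -/
lemma single_add_pathExp (n t : ℕ) (j : ZMod n) :
    Finsupp.single (j + (t : ZMod n)) 1 + pathExp n t (Finsupp.single j 1) =
      Finsupp.single j 1 + pathExp n t (Finsupp.single (j + 1) 1) := by
  rw [pathExp_single, pathExp_single, add_comm (Finsupp.single (j + (t : ZMod n)) 1),
    ← Finset.sum_range_succ (fun k : ℕ => Finsupp.single (j + (k : ZMod n)) 1),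
    Finset.sum_range_succ', add_comm]
  simp [add_assoc, add_comm (1 : ZMod n)]

/-- u_i u_{i+m} is the product of all the variables, whatever i is. -/
lemma pathExp_antipodal (m : ℕ) [NeZero (m + m)] (i j : ZMod (m + m)) :
    pathExp (m + m) m (Finsupp.single i 1 + Finsupp.single (i + m) 1) =
      pathExp (m + m) m (Finsupp.single j 1 + Finsupp.single (j + m) 1) := by
  classical
  have key : ∀ i : ZMod (m + m),
      pathExp (m + m) m (Finsupp.single i 1 + Finsupp.single (i + m) 1) =
        Finsupp.equivFunOnFinite.symm 1 := by
    intro i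
    ext k
    have h := pathExp_add_half m (Finsupp.single i 1) k
    rw [Finsupp.degree_single] at h
    rw [map_add, Finsupp.add_apply]
    simp only [Finsupp.equivFunOnFinite_symm_apply_apply, Pi.one_apply]
    refine Eq.trans ?_ h
    rw [pathExp_apply, pathExp_apply, pathExp_apply]
    congr 1
    refine Finset.sum_congr rfl fun l _ => ?_
    rw [Finsupp.single_apply, Finsupp.single_apply]
    congr 1
    rw [eq_sub_iff_add_eq, eq_sub_iff_add_eq]
    apply propext
    constructor
    · intro h; rw [← h, add_right_comm (i + (m : ZMod (m + m))), add_natCast_half_add]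
    · intro h; rw [add_right_comm, h, add_natCast_half_add]
  rw [key, key]

lemma sub_antipodal_of_pathExp_eq {m : ℕ} {b d : ZMod (m + m) →₀ ℕ}
    (h : pathExp (m + m) m b = pathExp (m + m) m d) (j : ZMod (m + m)) :
    b j + d (j + m) = d j + b (j + m) := by
  have h1 := pathExp_succ (m + m) m b (j - 1)
  have h2 := pathExp_succ (m + m) m d (j - 1)
  rw [h] at h1
  rw [sub_add_cancel, sub_natCast_half] at h1 h2
  omega

/-- Two different multisets of the same size: some index has a larger multiplicity in the first. -/
lemma exists_lt_of_degree_eq {σ : Type*} [Finite σ] {b d : σ →₀ ℕ} (hdeg : b.degree = d.degree)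
    (hne : b ≠ d) : ∃ j, d j < b j := by
  by_contra! hle
  cases nonempty_fintype σ
  apply hne
  rw [Finsupp.degree_eq_sum, Finsupp.degree_eq_sum,
    Finset.sum_eq_sum_iff_of_le fun i _ => hle i] at hdeg
  ext i
  exact hdeg i (Finset.mem_univ i)

lemma exists_eq_add_antipodal {m : ℕ} {b : ZMod (m + m) →₀ ℕ} {j : ZMod (m + m)}
    (hm : j ≠ j + m) (h1 : 0 < b j) (h2 : 0 < b (j + m)) :
    ∃ b', b = b' + (Finsupp.single j 1 + Finsupp.single (j + (m : ZMod (m + m))) 1) := by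
  classical
  refine ⟨b - (Finsupp.single j 1 + Finsupp.single (j + (m : ZMod (m + m))) 1),
    (tsub_add_cancel_of_le ?_).symm⟩
  intro k
  simp only [Finsupp.add_apply, Finsupp.single_apply]
  by_cases hk : j = k
  · subst hk; rw [if_pos rfl, if_neg hm.symm]; omega
  · rw [if_neg hk]
    split_ifs with hk2
    · subst hk2; omega
    · omega

lemma ne_add_half {m : ℕ} (hm : 0 < m) (j : ZMod (m + m)) : j ≠ j + m := by
  intro h
  have h0 : (m : ZMod (m + m)) = 0 := by simpa using h.symm
  rw [ZMod.natCast_eq_zero_iff] at h0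
  have := Nat.le_of_dvd hm h0
  omega

/-- Modulo an ideal identifying all the `y_j y_{j+m}`, a monomial in `y` depends only on its degree
and on its image under `y_j ↦ u_j`. -/
lemma monomial_sub_mem_of_antipodal (K : Type*) [Field K] {m : ℕ} (hm : 0 < m)
    (Q : Ideal (MvPolynomial (ZMod (m + m)) K))
    (hQ : ∀ i j : ZMod (m + m),
      monomial (Finsupp.single i 1 + Finsupp.single (i + (m : ZMod (m + m))) 1) (1 : K) -
        monomial (Finsupp.single j 1 + Finsupp.single (j + (m : ZMod (m + m))) 1) 1 ∈ Q)
    (b d : ZMod (m + m) →₀ ℕ) (hdeg : b.degree = d.degree)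
    (hexp : pathExp (m + m) m b = pathExp (m + m) m d) :
    monomial b (1 : K) - monomial d 1 ∈ Q := by
  have : NeZero (m + m) := ⟨by omega⟩
  induction hN : b.degree using Nat.strong_induction_on generalizing b d with
  | _ N ih =>
  by_cases hne : b = d
  · simp [hne]
  obtain ⟨j, hj⟩ := exists_lt_of_degree_eq hdeg hne
  obtain ⟨i, hi⟩ := exists_lt_of_degree_eq hdeg.symm (Ne.symm hne)
  have hj' := sub_antipodal_of_pathExp_eq hexp j
  have hi' := sub_antipodal_of_pathExp_eq hexp i
  -- The antipodal relation turns b_j > d_j into b_{j+m} > d_{j+m}, so y_j y_{j+m} divides y^b;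
  -- likewise for d at i.
  obtain ⟨b', hb'⟩ := exists_eq_add_antipodal (ne_add_half hm j) (b := b) (by omega) (by omega)
  obtain ⟨d', hd'⟩ := exists_eq_add_antipodal (ne_add_half hm i) (b := d) (by omega) (by omega)
  subst hb' hd'
  have hdeg' : b'.degree = d'.degree := by simpa using hdeg
  have hexp' : pathExp (m + m) m b' = pathExp (m + m) m d' := by
    rw [map_add, map_add _ d', pathExp_antipodal m j i] at hexp
    exact add_right_cancel hexp
  have h1 := ih b'.degree (by rw [← hN]; simp) b' d' hdeg' hexp' rfl
  have h2 := Q.add_mem (Q.mul_mem_left (monomial b' 1) (hQ j i))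
    (Q.mul_mem_right (monomial (Finsupp.single i 1 + Finsupp.single (i + (m : ZMod (m + m))) 1) 1) h1)
  simp only [mul_sub, sub_mul, monomial_mul, mul_one] at h2
  simpa using h2

end ReesPath

end

/-! ### Reduction of the kernel of φ to binomials. -/

open MvPolynomial

noncomputable section

namespace ReesPath

section General

variable {σ ι K : Type*} [Field K]

/-- The monomial `x^a y^b` of `T`. -/
def biMonomial (K : Type*) [Field K] (a : σ →₀ ℕ) (b : ι →₀ ℕ) : BigRing σ ι K :=
  monomial b (monomial a 1)

lemma biMonomial_mul (a c : σ →₀ ℕ) (b d : ι →₀ ℕ) :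
    biMonomial K a b * biMonomial K c d = biMonomial K (a + c) (b + d) := by
  simp [biMonomial, monomial_mul]

lemma biMonomial_single (i : σ) (j : ι) :
    biMonomial K (Finsupp.single i 1) (Finsupp.single j 1) = C (X i) * X j := by
  rw [biMonomial, C_mul_X_eq_monomial]
  rfl

lemma inclY_monomial (b : ι →₀ ℕ) :
    inclY σ ι K (monomial b 1) = biMonomial K 0 b := by
  simp [inclY, biMonomial, map_monomial]

/-- The map `T → S[s]` with `y_i ↦ u_i s`. -/
def reesEval (u : ι → MvPolynomial σ K) :
    BigRing σ ι K →ₐ[MvPolynomial σ K] Polynomial (MvPolynomial σ K) :=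
  aeval fun i => Polynomial.monomial 1 (u i)

lemma coe_reesMap (u : ι → MvPolynomial σ K) (p : BigRing σ ι K) :
    (reesMap u p : Polynomial (MvPolynomial σ K)) = reesEval u p := by
  have h : (reesAlgebra (genIdeal u)).val.comp (reesMap u) = reesEval u := by
    refine algHom_ext fun i => ?_
    simp [reesMap, reesEval, reesGen]
  exact DFunLike.congr_fun h p

lemma mem_definingIdeal (u : ι → MvPolynomial σ K) (p : BigRing σ ι K) :
    p ∈ definingIdeal u ↔ reesEval u p = 0 := by
  rw [definingIdeal, RingHom.mem_ker, ← coe_reesMap, ZeroMemClass.coe_eq_zero]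

/-- Used to lift elements of 𝔪 R(I) to 𝔪 T. -/
lemma reesMap_surjective (u : ι → MvPolynomial σ K) : Function.Surjective (reesMap u) := by
  have h : reesAlgebra (genIdeal u) ≤ (reesEval u).range := by
    rw [← adjoin_monomial_eq_reesAlgebra, Algebra.adjoin_le_iff]
    rintro _ ⟨p, hp, rfl⟩
    change Polynomial.monomial 1 p ∈ (reesEval u).range
    refine Submodule.span_induction (p := fun p _ => Polynomial.monomial 1 p ∈ (reesEval u).range)
      ?_ ?_ ?_ ?_ hp
    · rintro _ ⟨i, rfl⟩
      exact ⟨X i, by simp [reesEval]⟩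
    · simp
    · intro p q _ _ hp hq
      rw [map_add]
      exact add_mem hp hq
    · intro c p _ hp
      rw [← Polynomial.smul_monomial]
      exact Subalgebra.smul_mem _ hp c
  rintro ⟨p, hp⟩
  obtain ⟨q, hq⟩ := h hp
  exact ⟨q, Subtype.ext (by rw [coe_reesMap]; exact hq)⟩

lemma linearRelations_le_definingIdeal (u : ι → MvPolynomial σ K) :
    linearRelations u ≤ definingIdeal u := by
  refine Ideal.span_le.mpr ?_
  rintro _ ⟨a, ha, rfl⟩
  rw [SetLike.mem_coe, mem_definingIdeal, Finsupp.sum, map_sum]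
  have h : ∀ i ∈ a.support, reesEval u (C (a i) * X i) = Polynomial.monomial 1 (a i * u i) := by
    intro i _
    rw [C_mul', map_smul, reesEval, aeval_X, Polynomial.smul_monomial, smul_eq_mul]
  rw [Finset.sum_congr rfl h, ← map_sum]
  rw [Finsupp.sum] at ha
  rw [ha, map_zero]

/-- For a family of monomials, the binomials of `y`-degree-type `P` control the kernel of `φ`
on the polynomials whose `y`-monomials satisfy `P`. -/
lemma mem_of_reesEval_eq_zero {u : ι → MvPolynomial σ K} {e : (ι →₀ ℕ) → (σ →₀ ℕ)}
    (hu : ∀ a b, reesEval u (biMonomial K a b) =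
      Polynomial.monomial b.degree (monomial (a + e b) 1))
    (P : (ι →₀ ℕ) → Prop) (Q : Ideal (BigRing σ ι K))
    (hQ : ∀ a b c d, P b → P d → b.degree = d.degree → a + e b = c + e d →
      biMonomial K a b - biMonomial K c d ∈ Q)
    {τ : Type*} (s : Finset τ) (b : τ → ι →₀ ℕ) (q : τ → MvPolynomial σ K) (hP : ∀ t ∈ s, P (b t))
    (h0 : reesEval u (∑ t ∈ s, monomial (b t) (q t)) = 0) :
    ∑ t ∈ s, monomial (b t) (q t) ∈ Q := by
  classical
  -- The class modulo Q of any admissible monomial with image x^n s^r; by `hQ` the choice is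
  -- immaterial. The value 0 is a default for monomials not in the image.
  let A : ℕ → (σ →₀ ℕ) → BigRing σ ι K ⧸ Q := fun r n =>
    if h : ∃ ab : (σ →₀ ℕ) × (ι →₀ ℕ), P ab.2 ∧ ab.2.degree = r ∧ ab.1 + e ab.2 = n then
      Ideal.Quotient.mk Q (biMonomial K h.choose.1 h.choose.2) else 0
  have hA : ∀ a b, P b → A b.degree (a + e b) = Ideal.Quotient.mk Q (biMonomial K a b) := by
    intro a b hb
    have h : ∃ ab : (σ →₀ ℕ) × (ι →₀ ℕ),
        P ab.2 ∧ ab.2.degree = b.degree ∧ ab.1 + e ab.2 = a + e b := ⟨(a, b), hb, rfl, rfl⟩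
    simp only [A]
    rw [dif_pos h]
    exact Ideal.Quotient.eq.mpr (hQ _ _ _ _ h.choose_spec.1 hb h.choose_spec.2.1 h.choose_spec.2.2)
  -- On admissible polynomials, B ∘ `reesEval` is the quotient map to T/Q, so whatever `reesEval`
  -- kills lies in Q.
  let B : Polynomial (MvPolynomial σ K) →ₗ[K] BigRing σ ι K ⧸ Q :=
    Polynomial.lsum fun r => (basisMonomials σ K).constr K (A r)
  have hB : ∀ b, P b → ∀ q : MvPolynomial σ K,
      B (reesEval u (monomial b q)) = Ideal.Quotient.mk Q (monomial b q) := by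
    intro b hb q
    induction q using MvPolynomial.induction_on' with
    | add p q hp hq => rw [map_add, map_add, map_add, map_add, hp, hq]
    | monomial a k =>
      have h1 : (monomial b (monomial a k) : BigRing σ ι K) = k • biMonomial K a b := by
        rw [biMonomial, smul_monomial, smul_monomial, smul_eq_mul, mul_one]
      have h2 : Ideal.Quotient.mk Q (k • biMonomial K a b) =
          k • Ideal.Quotient.mk Q (biMonomial K a b) :=
        map_smul (Ideal.Quotient.mkₐ K Q) k _
      have h3 : reesEval u (k • biMonomial K a b) = k • reesEval u (biMonomial K a b) :=
        map_smul ((reesEval u).restrictScalars K) k _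
      rw [h1, h2, h3, map_smul, hu, ← hA a b hb]
      congr 1
      have h4 : (monomial (a + e b) 1 : MvPolynomial σ K) = basisMonomials σ K (a + e b) := by
        rw [coe_basisMonomials]
      simp only [B, Polynomial.lsum_apply]
      rw [Polynomial.sum_monomial_index _ _ (LinearMap.map_zero _), h4, Module.Basis.constr_basis]
  rw [← Ideal.Quotient.eq_zero_iff_mem, map_sum, ← Finset.sum_congr rfl fun t ht =>
    hB (b t) (hP t ht) (q t), ← map_sum, ← map_sum, h0, map_zero]

end General

end ReesPath

end

/-! ### Paths of the cycle and the generators of the path ideal. -/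

open MvPolynomial

noncomputable section

namespace ReesPath

lemma cycle_adj {n : ℕ} (hn : 2 ≤ n) (u v : ZMod n) :
    (cycle n).Adj u v ↔ v = u + 1 ∨ v = u - 1 := by
  have : Nontrivial (ZMod n) := ZMod.nontrivial_iff.mpr (by omega)
  simp only [cycle, SimpleGraph.circulantGraph_adj, Set.mem_singleton_iff]
  constructor
  · rintro ⟨-, h | h⟩
    · right; rw [← h]; ring
    · left; rw [← h]; ring
  · rintro (rfl | rfl) <;> simp [eq_sub_iff_add_eq]

/-- The walk `j, j + 1, …, j + k` in the cycle. -/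
lemma exists_walk_cycle {n : ℕ} (hn : 2 ≤ n) (k : ℕ) (j : ZMod n) :
    ∃ (w : ZMod n) (p : (cycle n).Walk j w),
      p.support = (List.range (k + 1)).map fun i : ℕ => j + (i : ZMod n) := by
  induction k generalizing j with
  | zero => exact ⟨j, .nil, by simp⟩
  | succ k ih =>
    obtain ⟨w, p, hp⟩ := ih (j + 1)
    refine ⟨w, .cons ((cycle_adj hn _ _).mpr (Or.inl rfl)) p, ?_⟩
    rw [SimpleGraph.Walk.support_cons, hp, List.range_succ_eq_map (n := k + 1)]
    simp [Function.comp_def, add_assoc, add_comm (1 : ZMod n)]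

/-- A path in the cycle runs in a constant direction. -/
lemma support_of_isPath_cycle {n : ℕ} (hn : 2 ≤ n) {v w : ZMod n} (p : (cycle n).Walk v w)
    (hp : p.IsPath) :
    ∃ ε : ZMod n, (ε = 1 ∨ ε = -1) ∧
      p.support = (List.range (p.length + 1)).map fun i : ℕ => v + (i : ZMod n) * ε := by
  induction p with
  | nil => exact ⟨1, Or.inl rfl, by simp⟩
  | @cons v v' w h q ih =>
    rw [SimpleGraph.Walk.cons_isPath_iff] at hp
    obtain ⟨ε, hε, hq⟩ := ih hp.1
    have hv := (cycle_adj hn v v').mp h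
    obtain ⟨δ, hδ, rfl⟩ : ∃ δ : ZMod n, (δ = 1 ∨ δ = -1) ∧ v' = v + δ := by
      rcases hv with hv | hv
      · exact ⟨1, Or.inl rfl, hv⟩
      · exact ⟨-1, Or.inr rfl, by rw [hv]; ring⟩
    -- A reversal of direction would make v the second vertex of q.
    have hlen : q.length = 0 ∨ ε = δ := by
      by_contra! hcon
      refine hp.2 ?_
      rw [hq, List.mem_map]
      refine ⟨1, List.mem_range.mpr (by omega), ?_⟩
      rcases hε with rfl | rfl <;> rcases hδ with rfl | rfl <;> simp_all
    refine ⟨δ, hδ, ?_⟩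
    have hq' : q.support = (List.range (q.length + 1)).map fun i : ℕ => v + δ + (i : ZMod n) * δ := by
      rcases hlen with h0 | rfl
      · rw [hq, h0]; simp
      · exact hq
    rw [SimpleGraph.Walk.support_cons, hq', SimpleGraph.Walk.length_cons,
      List.range_succ_eq_map (n := q.length + 1)]
    simp only [List.map_cons, List.map_map, Function.comp_def, Nat.cast_zero, zero_mul, add_zero,
      Nat.cast_succ, add_mul, one_mul, List.cons.injEq, true_and]
    refine List.map_congr_left fun i _ => ?_
    ring

lemma prod_map_range_eq {M : Type*} [CommMonoid M] (g : ℕ → M) (t : ℕ) :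
    ((List.range t).map g).prod = ∏ k ∈ Finset.range t, g k := by
  rw [Finset.prod_eq_multiset_prod, Finset.range_val, Multiset.range, Multiset.map_coe,
    Multiset.prod_coe]

lemma genIdeal_cyclePathMonomial (K : Type*) [Field K] {n t : ℕ} (hn : 2 ≤ n) (ht : 1 ≤ t)
    (htn : t ≤ n) : genIdeal (cyclePathMonomial K n t) = pathIdeal K (cycle n) t := by
  apply le_antisymm
  · refine Ideal.span_le.mpr ?_
    rintro _ ⟨j, rfl⟩
    obtain ⟨t, rfl⟩ : ∃ s, t = s + 1 := ⟨t - 1, by omega⟩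
    obtain ⟨w, p, hp⟩ := exists_walk_cycle hn t j
    refine Ideal.subset_span ⟨j, w, p, ?_, by simp [hp], ?_⟩
    · rw [SimpleGraph.Walk.isPath_def, hp]
      refine List.Nodup.map_on ?_ List.nodup_range
      intro k hk l hl hkl
      have h := add_left_cancel hkl
      rw [ZMod.natCast_eq_natCast_iff',
        Nat.mod_eq_of_lt (by have := List.mem_range.mp hk; omega),
        Nat.mod_eq_of_lt (by have := List.mem_range.mp hl; omega)] at h
      exact h
    · rw [hp, List.map_map, prod_map_range_eq]; rfl
  · refine Ideal.span_le.mpr ?_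
    rintro _ ⟨v, w, p, hp, hlen, rfl⟩
    obtain ⟨ε, hε, hs⟩ := support_of_isPath_cycle hn p hp
    rw [SimpleGraph.Walk.length_support] at hlen
    rw [hs, hlen, List.map_map, prod_map_range_eq]
    refine Ideal.subset_span ?_
    rcases hε with rfl | rfl
    · exact ⟨v, by simp [cyclePathMonomial]⟩
    · refine ⟨v - ((t - 1 : ℕ) : ZMod n), ?_⟩
      rw [cyclePathMonomial, ← Finset.prod_range_reflect]
      refine Finset.prod_congr rfl fun k hk => ?_
      have hk' := Finset.mem_range.mp hk
      have h1 : t - 1 = (t - 1 - k) + k := by omega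
      simp only [Function.comp_apply]
      congr 1
      conv_lhs => rw [h1]
      rw [Nat.add_sub_cancel]
      push_cast
      ring

end ReesPath

end

/-! ### The binomial reduction, and the ideals L and J. -/

open MvPolynomial

noncomputable section

namespace ReesPath

lemma cyclePathMonomial_eq_monomial (K : Type*) [Field K] (n t : ℕ) (j : ZMod n) :
    cyclePathMonomial K n t j = monomial (pathExp n t (Finsupp.single j 1)) 1 := by
  rw [pathExp_single, monomial_sum_one]
  rfl

lemma reesEval_cyclePathMonomial (K : Type*) [Field K] (n t : ℕ) (a b : ZMod n →₀ ℕ) :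
    reesEval (cyclePathMonomial K n t) (biMonomial K a b) =
      Polynomial.monomial b.degree (monomial (a + pathExp n t b) 1) := by
  induction b using Finsupp.induction_linear generalizing a with
  | zero =>
    rw [biMonomial, ← C_apply, reesEval, aeval_C]
    simp [Polynomial.monomial_zero_left, Polynomial.algebraMap_eq]
  | add b c hb hc =>
    have h : biMonomial K a (b + c) = biMonomial K a b * biMonomial K 0 c := by
      rw [biMonomial_mul, add_zero]
    rw [h, map_mul, hb, hc, Polynomial.monomial_mul_monomial, monomial_mul]
    simp [add_assoc]
  | single j k =>
    have h : (biMonomial K a (Finsupp.single j k) : BigRing _ _ K) = C (monomial a 1) * X j ^ k := by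
      rw [biMonomial, C_mul_X_pow_eq_monomial]
    rw [h, reesEval, map_mul, aeval_C, map_pow, aeval_X, Polynomial.monomial_pow,
      cyclePathMonomial_eq_monomial, monomial_pow, Polynomial.algebraMap_eq, Polynomial.C_mul_monomial,
      monomial_mul, ← map_nsmul, Finsupp.smul_single]
    simp

lemma biMonomial_sub_mem_definingIdeal (K : Type*) [Field K] {n t : ℕ} {a b c d : ZMod n →₀ ℕ}
    (hdeg : b.degree = d.degree) (hexp : a + pathExp n t b = c + pathExp n t d) :
    biMonomial K a b - biMonomial K c d ∈ definingIdeal (cyclePathMonomial K n t) := by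
  rw [mem_definingIdeal, map_sub, reesEval_cyclePathMonomial, reesEval_cyclePathMonomial, hdeg, hexp,
    sub_self]

/-- The relation f_j replaces x_j y_{j+1} in x^a y^b by x_{j+m} y_j; then x_{j+m} is shared with x^c
and cancels, leaving a pair covered by `ih`. -/
lemma biMonomial_sub_mem_of_step {K : Type*} [Field K] {m : ℕ} {r : ℕ}
    {Q : Ideal (BigRing (ZMod (m + m)) (ZMod (m + m)) K)}
    (hf : ∀ j : ZMod (m + m),
      biMonomial K (Finsupp.single (j + m) 1) (Finsupp.single j 1) -
        biMonomial K (Finsupp.single j 1) (Finsupp.single (j + 1) 1) ∈ Q)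
    {a b c d : ZMod (m + m) →₀ ℕ}
    (ih : ∀ a' b' c' d' : ZMod (m + m) →₀ ℕ, a'.degree + c'.degree < a.degree + c.degree →
      b'.degree = r → d'.degree = r →
      a' + pathExp (m + m) m b' = c' + pathExp (m + m) m d' →
      biMonomial K a' b' - biMonomial K c' d' ∈ Q)
    (hb : b.degree = r) (hd : d.degree = r)
    (hexp : a + pathExp (m + m) m b = c + pathExp (m + m) m d)
    {j : ZMod (m + m)} (haj : 0 < a j) (hbj : 0 < b (j + 1)) (hcj : 0 < c (j + m)) :
    biMonomial K a b - biMonomial K c d ∈ Q := by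
  classical
  have aux : ∀ (b : ZMod (m + m) →₀ ℕ) (i : ZMod (m + m)), 0 < b i →
      ∃ b', b = b' + Finsupp.single i 1 := fun b i h =>
    ⟨b - Finsupp.single i 1, (tsub_add_cancel_of_le (Finsupp.single_le_iff.mpr h)).symm⟩
  obtain ⟨a', rfl⟩ := aux a j haj
  obtain ⟨b', rfl⟩ := aux b _ hbj
  obtain ⟨c', rfl⟩ := aux c _ hcj
  have hE := single_add_pathExp (m + m) m j
  have hexp' : a' + pathExp (m + m) m (b' + Finsupp.single j 1) = c' + pathExp (m + m) m d := by
    rw [map_add] at hexp ⊢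
    apply add_right_cancel (b := Finsupp.single (j + (m : ZMod (m + m))) 1)
    rw [add_right_comm c', ← hexp]
    calc a' + (pathExp (m + m) m b' + pathExp (m + m) m (Finsupp.single j 1)) +
          Finsupp.single (j + (m : ZMod (m + m))) 1
        = a' + pathExp (m + m) m b' + (Finsupp.single (j + (m : ZMod (m + m))) 1 +
          pathExp (m + m) m (Finsupp.single j 1)) := by abel
      _ = _ := by rw [hE]; abel
  have h1 := ih a' (b' + Finsupp.single j 1) c' d (by simp; omega) (by simpa using hb) hd hexp'
  have h2 := Q.sub_mem
    (Q.mul_mem_left (biMonomial K (Finsupp.single (j + (m : ZMod (m + m))) 1) 0) h1)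
    (Q.mul_mem_left (biMonomial K a' b') (hf j))
  simp only [mul_sub, biMonomial_mul, zero_add] at h2
  rw [add_comm a' (Finsupp.single (j + (m : ZMod (m + m))) 1),
    add_comm c', sub_sub_sub_cancel_left] at *
  convert h2 using 2

/-- An ideal containing all the `f_j` and all the differences of `y`-monomials of degree `r` with
the same image contains all the differences of monomials of `y`-degree `r` with the same image. -/
lemma biMonomial_sub_mem {K : Type*} [Field K] {m : ℕ} (hm : 0 < m) {r : ℕ}
    {Q : Ideal (BigRing (ZMod (m + m)) (ZMod (m + m)) K)}
    (hf : ∀ j : ZMod (m + m),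
      biMonomial K (Finsupp.single (j + m) 1) (Finsupp.single j 1) -
        biMonomial K (Finsupp.single j 1) (Finsupp.single (j + 1) 1) ∈ Q)
    (hQ : ∀ b d : ZMod (m + m) →₀ ℕ, b.degree = r → d.degree = r →
      pathExp (m + m) m b = pathExp (m + m) m d → biMonomial K 0 b - biMonomial K 0 d ∈ Q)
    (a b c d : ZMod (m + m) →₀ ℕ) (hb : b.degree = r) (hd : d.degree = r)
    (hexp : a + pathExp (m + m) m b = c + pathExp (m + m) m d) :
    biMonomial K a b - biMonomial K c d ∈ Q := by
  have : NeZero (m + m) := ⟨by omega⟩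
  induction hN : a.degree + c.degree using Nat.strong_induction_on generalizing a b c d with
  | _ N ih =>
  by_cases hac : a = c
  · subst hac
    have h := Q.mul_mem_left (biMonomial K a 0) (hQ b d hb hd (add_left_cancel hexp))
    simpa [mul_sub, biMonomial_mul] using h
  have hpt : ∀ i, a i + pathExp (m + m) m b i = c i + pathExp (m + m) m d i := fun i =>
    DFunLike.congr_fun hexp i
  have hhalf : ∀ i, a i + a (i + m) = c i + c (i + m) := by
    intro i
    have h1 := pathExp_add_half m b i
    have h2 := pathExp_add_half m d i
    have h3 := hpt i
    have h4 := hpt (i + m)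
    omega
  obtain ⟨i, hi⟩ : ∃ i, c i < a i := by
    by_contra! hcon
    apply hac
    ext i
    have h1 := hcon i
    have h2 := hcon (i + m)
    have h3 := hhalf i
    omega
  -- Otherwise a - c stays positive from i up to i+m, against its antipodal sign change.
  obtain ⟨j, hj, hj'⟩ : ∃ j, c j < a j ∧ a (j + 1) + c j < a j + c (j + 1) := by
    by_contra! hcon
    have hall : ∀ k : ℕ, c (i + k) < a (i + k) := by
      intro k
      induction k with
      | zero => simpa using hi
      | succ k ihk =>
        have := hcon _ ihk
        rw [Nat.cast_succ, ← add_assoc]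
        omega
    have h1 := hall m
    have h2 := hhalf i
    omega
  have h1 := hhalf j
  have h2 := pathExp_succ (m + m) m b j
  have h3 := pathExp_succ (m + m) m d j
  have h4 := hpt j
  have h5 := hpt (j + 1)
  rw [sub_natCast_half] at h2 h3
  -- The drop of a - c at j equals (b_{j+1} - b_{j+1+m}) - (d_{j+1} - d_{j+1+m}).
  have hor : 0 < b (j + 1) ∨ 0 < d (j + 1 + m) := by omega
  rcases hor with hor | hor
  · exact biMonomial_sub_mem_of_step hf
      (fun a' b' c' d' hlt hb' hd' he => ih _ (hN ▸ hlt) a' b' c' d' hb' hd' he rfl)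
      hb hd hexp (j := j) (by omega) hor (by omega)
  · rw [← neg_sub]
    refine Q.neg_mem (biMonomial_sub_mem_of_step hf
      (fun a' b' c' d' hlt hb' hd' he => ih _ (by omega) a' b' c' d' hb' hd' he rfl)
      hd hb hexp.symm (j := j + m) (by omega) ?_ ?_)
    · rwa [add_right_comm]
    · rw [add_natCast_half_add]
      omega

lemma f_eq_biMonomial_sub (K : Type*) [Field K] (m : ℕ) (j : ZMod (m + m)) :
    f K (m + m) j = biMonomial K (Finsupp.single (j + (m : ZMod (m + m))) 1) (Finsupp.single j 1) -
      biMonomial K (Finsupp.single j 1) (Finsupp.single (j + 1) 1) := by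
  have h : (m + m) / 2 = m := by omega
  rw [f, h, biMonomial_single, biMonomial_single, add_comm (m : ZMod (m + m))]

lemma h_eq_monomial_sub (K : Type*) [Field K] (m l : ℕ) :
    h K (m + m) l =
      monomial (Finsupp.single (l : ZMod (m + m)) 1 +
        Finsupp.single ((l : ZMod (m + m)) + (m : ZMod (m + m))) 1) 1 -
      monomial (Finsupp.single (0 : ZMod (m + m)) 1 +
        Finsupp.single ((0 : ZMod (m + m)) + (m : ZMod (m + m))) 1) 1 := by
  have h0 : (m + m) / 2 = m := by omega
  rw [h, h0, Nat.cast_add, zero_add]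
  simp [X, monomial_mul]

/-- The pair {i, i+m} depends only on i modulo m, so the indices 0 ≤ l < m suffice, and h_0 = 0. -/
lemma antipodal_sub_mem_span_h (K : Type*) [Field K] {m : ℕ} (hm : 0 < m) (i j : ZMod (m + m)) :
    monomial (Finsupp.single i 1 + Finsupp.single (i + (m : ZMod (m + m))) 1) (1 : K) -
      monomial (Finsupp.single j 1 + Finsupp.single (j + (m : ZMod (m + m))) 1) 1 ∈
        Ideal.span (h K (m + m) '' {l | 1 ≤ l ∧ l ≤ (m + m) / 2 - 1}) := by
  have : NeZero (m + m) := ⟨by omega⟩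
  set Q := Ideal.span (h K (m + m) '' {l | 1 ≤ l ∧ l ≤ (m + m) / 2 - 1})
  have hlt : ∀ l : ℕ, l < m → h K (m + m) l ∈ Q := by
    intro l hl
    rcases Nat.eq_zero_or_pos l with rfl | hl0
    · rw [h_eq_monomial_sub]
      simp
    · exact Ideal.subset_span ⟨l, ⟨hl0, by omega⟩, rfl⟩
  have key : ∀ i : ZMod (m + m),
      monomial (Finsupp.single i 1 + Finsupp.single (i + (m : ZMod (m + m))) 1) (1 : K) -
        monomial (Finsupp.single (0 : ZMod (m + m)) 1 +
          Finsupp.single ((0 : ZMod (m + m)) + (m : ZMod (m + m))) 1) 1 ∈ Q := by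
    intro i
    have hi := ZMod.val_lt i
    rcases lt_or_ge i.val m with hlt' | hge
    · have := hlt _ hlt'
      rwa [h_eq_monomial_sub, ZMod.natCast_zmod_val] at this
    · have := hlt (i.val - m) (by omega)
      rwa [h_eq_monomial_sub, Nat.cast_sub hge, ZMod.natCast_zmod_val, sub_add_cancel,
        sub_natCast_half, add_comm (Finsupp.single (i + (m : ZMod (m + m))) 1)] at this
  have h := Q.sub_mem (key i) (key j)
  rwa [sub_sub_sub_cancel_right] at h

lemma biMonomial_sub_mem_span_f (K : Type*) [Field K] {m : ℕ} (hm : 2 ≤ m)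
    (a b c d : ZMod (m + m) →₀ ℕ) (hb : b.degree = 1) (hd : d.degree = 1)
    (hexp : a + pathExp (m + m) m b = c + pathExp (m + m) m d) :
    biMonomial K a b - biMonomial K c d ∈ Ideal.span (Set.range (f K (m + m))) := by
  classical
  refine biMonomial_sub_mem (by omega)
    (fun j => f_eq_biMonomial_sub K m j ▸ Ideal.subset_span (Set.mem_range_self j)) ?_ a b c d hb hd hexp
  intro b d hb hd hexp
  have : NeZero (m + m) := ⟨by omega⟩
  by_cases hne : b = d
  · simp [hne]
  exfalso
  -- An antipodal pair would divide y^b, which has degree 1.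
  obtain ⟨j, hj⟩ := exists_lt_of_degree_eq (hb.trans hd.symm) hne
  have h1 := sub_antipodal_of_pathExp_eq hexp j
  obtain ⟨b', rfl⟩ := exists_eq_add_antipodal (ne_add_half (by omega) j) (b := b)
    (by omega) (by omega)
  simp at hb

lemma linearRelations_cyclePathMonomial (K : Type*) [Field K] {m : ℕ} (hm : 2 ≤ m) :
    linearRelations (cyclePathMonomial K (m + m) m) = Ideal.span (Set.range (f K (m + m))) := by
  apply le_antisymm
  · refine Ideal.span_le.mpr ?_
    rintro _ ⟨a, ha, rfl⟩
    -- A linear form of L lies in J and has y-degree 1, so only binomials of y-degree 1 are needed.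
    have hJ := linearRelations_le_definingIdeal (cyclePathMonomial K (m + m) m)
      (show (a.sum fun i c => C c * X i) ∈ _ from Ideal.subset_span ⟨a, ha, rfl⟩)
    rw [mem_definingIdeal] at hJ
    simp only [Finsupp.sum, C_mul_X_eq_monomial] at hJ ⊢
    exact mem_of_reesEval_eq_zero (reesEval_cyclePathMonomial K (m + m) m) (fun b => b.degree = 1) _
      (fun a b c d hb hd _ he => biMonomial_sub_mem_span_f K hm a b c d hb hd he) a.support
      (fun i => Finsupp.single i 1) a (fun i _ => Finsupp.degree_single i 1) hJ
  · refine Ideal.span_le.mpr ?_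
    rintro _ ⟨j, rfl⟩
    have h0 : (m + m) / 2 = m := by omega
    refine Ideal.subset_span
      ⟨Finsupp.single j (X (j + (m : ZMod (m + m)))) - Finsupp.single (j + 1) (X j), ?_, ?_⟩
    · rw [Finsupp.sum_sub_index (fun _ _ _ => sub_mul _ _ _),
        Finsupp.sum_single_index (zero_mul _), Finsupp.sum_single_index (zero_mul _),
        cyclePathMonomial_eq_monomial, cyclePathMonomial_eq_monomial, X, X, monomial_mul, monomial_mul,
        single_add_pathExp, sub_self]
    · rw [Finsupp.sum_sub_index (fun _ _ _ => by rw [map_sub, sub_mul]),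
        Finsupp.sum_single_index (by simp), Finsupp.sum_single_index (by simp), f, h0,
        add_comm (m : ZMod (m + m))]

lemma definingIdeal_cyclePathMonomial (K : Type*) [Field K] {m : ℕ} (hm : 2 ≤ m) :
    definingIdeal (cyclePathMonomial K (m + m) m) =
      Ideal.span (Set.range (f K (m + m))) +
        (Ideal.span (h K (m + m) '' {l | 1 ≤ l ∧ l ≤ (m + m) / 2 - 1})).map
          (inclY (ZMod (m + m)) (ZMod (m + m)) K) := by
  have : NeZero (m + m) := ⟨by omega⟩
  apply le_antisymm
  · intro p hp
    rw [mem_definingIdeal] at hp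
    rw [← support_sum_monomial_coeff p] at hp ⊢
    refine mem_of_reesEval_eq_zero (reesEval_cyclePathMonomial K (m + m) m) (fun _ => True) _
      (fun a b c d _ _ hdeg he => ?_) p.support id (fun b => coeff b p) (fun _ _ => trivial) hp
    refine biMonomial_sub_mem (r := d.degree) (by omega)
      (fun j => f_eq_biMonomial_sub K m j ▸
        Ideal.mem_sup_left (Ideal.subset_span (Set.mem_range_self j))) ?_
      a b c d hdeg rfl he
    intro b d hb hd he
    rw [← inclY_monomial, ← inclY_monomial, ← map_sub]
    exact Ideal.mem_sup_right (Ideal.mem_map_of_mem _ (monomial_sub_mem_of_antipodal K (by omega) _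
      (antipodal_sub_mem_span_h K (by omega)) b d (hb.trans hd.symm) he))
  · refine sup_le ?_ ?_
    · rw [← linearRelations_cyclePathMonomial K hm]
      exact linearRelations_le_definingIdeal _
    · rw [Ideal.map_span]
      refine Ideal.span_le.mpr ?_
      rintro _ ⟨_, ⟨l, -, rfl⟩, rfl⟩
      rw [h_eq_monomial_sub, map_sub, inclY_monomial, inclY_monomial]
      exact biMonomial_sub_mem_definingIdeal K (by simp) (by rw [pathExp_antipodal m _ 0])

/-! ### Fiber relations, by setting x = 0. -/

lemma map_constantCoeff_inclY {σ ι K : Type*} [Field K] (g : MvPolynomial ι K) :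
    MvPolynomial.map (constantCoeff (R := K) (σ := σ)) (inclY σ ι K g) = g := by
  have h : (constantCoeff (R := K) (σ := σ)).comp C = RingHom.id K := by ext; simp
  rw [inclY, map_map, h, map_id]

lemma maxIdeal_map_le_ker {σ ι K : Type*} [Field K] :
    (maxIdeal σ K).map (C : MvPolynomial σ K →+* BigRing σ ι K) ≤
      RingHom.ker (MvPolynomial.map (constantCoeff (R := K) (σ := σ)) : BigRing σ ι K →+* _) := by
  rw [maxIdeal, Ideal.map_span, Ideal.span_le]
  rintro _ ⟨_, ⟨i, rfl⟩, rfl⟩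
  simp [RingHom.mem_ker]

/-- If `J` is generated by elements of `𝔪 T` and an ideal `H₀` of `K[y]`, then `H₀` is the ideal of
fiber relations. -/
lemma fiberRelations_eq_of_definingIdeal {σ ι K : Type*} [Field K] {u : ι → MvPolynomial σ K}
    {L₀ : Ideal (BigRing σ ι K)} {H₀ : Ideal (MvPolynomial ι K)}
    (hL : L₀ ≤ (maxIdeal σ K).map (C : MvPolynomial σ K →+* BigRing σ ι K))
    (hJ : definingIdeal u = L₀ + H₀.map (inclY σ ι K)) : fiberRelations u = H₀ := by
  apply le_antisymm
  · intro g hg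
    have hg' : reesMap u (inclY σ ι K g) ∈ maxReesIdeal u := Ideal.Quotient.eq_zero_iff_mem.mp hg
    have hmap : maxReesIdeal u =
        ((maxIdeal σ K).map (C : MvPolynomial σ K →+* BigRing σ ι K)).map (reesMap u) := by
      rw [maxReesIdeal, ← (reesMap u).comp_algebraMap, ← Ideal.map_map]
      rfl
    rw [hmap] at hg'
    obtain ⟨t, ht, hte⟩ := (Ideal.mem_map_iff_of_surjective _ (reesMap_surjective u)).mp hg'
    have hd : inclY σ ι K g - t ∈ definingIdeal u := by
      change reesMap u (inclY σ ι K g - t) = 0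
      rw [map_sub, hte, sub_self]
    rw [hJ] at hd
    -- g = (g - t) + t with g - t in J and t in 𝔪 T; setting x = 0 then leaves only the part from
    -- `H₀`.
    have hsum : inclY σ ι K g ∈
        RingHom.ker (MvPolynomial.map (constantCoeff (R := K) (σ := σ)) : BigRing σ ι K →+* _) ⊔
          H₀.map (inclY σ ι K) := by
      rw [← sub_add_cancel (inclY σ ι K g) t]
      exact add_mem (sup_le_sup_right (hL.trans maxIdeal_map_le_ker) _ hd)
        (Ideal.mem_sup_left (maxIdeal_map_le_ker ht))
    obtain ⟨p, hp, q, hq, hpq⟩ := Submodule.mem_sup.mp hsum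
    have hq' := Ideal.mem_map_of_mem (MvPolynomial.map (constantCoeff (R := K) (σ := σ))) hq
    have hid : (MvPolynomial.map (constantCoeff (R := K) (σ := σ))).comp (inclY σ ι K) =
        RingHom.id _ := RingHom.ext map_constantCoeff_inclY
    rw [Ideal.map_map, hid, Ideal.map_id] at hq'
    rw [← map_constantCoeff_inclY (σ := σ) g, ← hpq, map_add, RingHom.mem_ker.mp hp, zero_add]
    exact hq'
  · intro g hg
    have h1 : inclY σ ι K g ∈ definingIdeal u := by
      rw [hJ]
      exact Ideal.mem_sup_right (Ideal.mem_map_of_mem _ hg)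
    change Ideal.Quotient.mk (maxReesIdeal u) (reesMap u (inclY σ ι K g)) = 0
    rw [show reesMap u (inclY σ ι K g) = 0 from h1, map_zero]

lemma span_f_le_maxIdeal_map (K : Type*) [Field K] (n : ℕ) :
    Ideal.span (Set.range (f K n)) ≤
      (maxIdeal (ZMod n) K).map (C : MvPolynomial (ZMod n) K →+* BigRing (ZMod n) (ZMod n) K) := by
  refine Ideal.span_le.mpr ?_
  rintro _ ⟨j, rfl⟩
  have hX : ∀ i : ZMod n, (X i : MvPolynomial (ZMod n) K) ∈ maxIdeal (ZMod n) K := fun i =>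
    Ideal.subset_span ⟨i, rfl⟩
  exact Ideal.sub_mem _ (Ideal.mul_mem_right _ _ (Ideal.mem_map_of_mem _ (hX _)))
    (Ideal.mul_mem_right _ _ (Ideal.mem_map_of_mem _ (hX _)))

end ReesPath

end

theorem mainTheorem2 {K : Type*} [Field K] (n : ℕ) (hn : 4 ≤ n) (hn2 : Even n) :
    -- the monomials `u_j` are generators of `I_{n/2}(C_n)`
    ReesPath.genIdeal (ReesPath.cyclePathMonomial K n (n / 2)) =
        ReesPath.pathIdeal K (ReesPath.cycle n) (n / 2) ∧
    -- `L = (f_1, …, f_n)`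
    ReesPath.linearRelations (ReesPath.cyclePathMonomial K n (n / 2)) =
        Ideal.span (Set.range (ReesPath.f K n)) ∧
    -- `H = (h_1, …, h_{n/2-1})`
    ReesPath.fiberRelations (ReesPath.cyclePathMonomial K n (n / 2)) =
        Ideal.span (ReesPath.h K n '' {l | 1 ≤ l ∧ l ≤ n / 2 - 1}) ∧
    -- `J = L + H T`
    ReesPath.definingIdeal (ReesPath.cyclePathMonomial K n (n / 2)) =
        Ideal.span (Set.range (ReesPath.f K n)) +
          (Ideal.span (ReesPath.h K n '' {l | 1 ≤ l ∧ l ≤ n / 2 - 1})).map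
            (ReesPath.inclY (ZMod n) (ZMod n) K) ∧
    -- `I_{n/2}(C_n)` is of fiber type
    ReesPath.IsFiberType (ReesPath.cyclePathMonomial K n (n / 2)) := by
  obtain ⟨m, rfl⟩ := hn2
  have hm : 2 ≤ m := by omega
  have h2 : (m + m) / 2 = m := by omega
  have hL := ReesPath.linearRelations_cyclePathMonomial K hm
  have hJ := ReesPath.definingIdeal_cyclePathMonomial K hm
  have hH := ReesPath.fiberRelations_eq_of_definingIdeal (ReesPath.span_f_le_maxIdeal_map K (m + m)) hJ
  have hI := ReesPath.genIdeal_cyclePathMonomial K (n := m + m) (t := m) (by omega) (by omega)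
    (by omega)
  rw [h2] at hH hJ ⊢
  refine ⟨hI, hL, hH, hJ, ?_⟩
  rw [ReesPath.IsFiberType, hL, hH, hJ]
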